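/- Let $p$ be a prime and let $G$ be a finite nonabelian $p$-group of maximal nilpotency class, that is, $|G| = p^n$ for some $n \geq 2$ and $G$ has nilpotency class $n-1$. Then $G$ is an S-group, that is, \[ \hat{H}^0\bigl(G/\Phi(G);\, Z(\Phi(G))\bigr) \neq 0, \] where $\Phi(G)$ is the Frattini subgroup of $G$, $Z(\Phi(G))$ is the center of $\Phi(G)$, regarded as a $\mathbb{Z}[G/\Phi(G)]$-module through the conjugation action, and $\hat{H}^0$ denotes Tate cohomology in degree $0$. -/

import Mathlib

universe u

/-- The conjugation action of `G` on the center `Z(Φ(G))` of its Frattini subgroup. -/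
def conjCenterFrattini (G : Type u) [Group G] :
    G →* MulAut (Subgroup.center (frattini G)) where
  toFun g := Subgroup.centerCongr (MulAut.conjNormal g : MulAut (frattini G))
  map_one' := by ext a; change (1 : G) * ((a : frattini G) : G) * 1⁻¹ = _; simp
  map_mul' g h := by
    ext a
    change (g * h) * ((a : frattini G) : G) * (g * h)⁻¹ = g * (h * ((a : frattini G) : G) * h⁻¹) * g⁻¹
    group

/-- The conjugation action of `g : G` sends `a` to `g a g⁻¹`. -/
theorem conjCenterFrattini_apply (G : Type u) [Group G] (g : G)
    (a : Subgroup.center (frattini G)) :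
    ((conjCenterFrattini G g a : frattini G) : G) = g * ((a : frattini G) : G) * g⁻¹ := rfl

/-- `Φ(G)` acts trivially on its center. -/
theorem conjCenterFrattini_of_mem (G : Type u) [Group G] (g : G) (hg : g ∈ frattini G) :
    conjCenterFrattini G g = 1 := by
  ext a
  have h := congrArg Subtype.val (Subgroup.mem_center_iff.mp a.2 ⟨g, hg⟩)
  rw [conjCenterFrattini_apply, MulAut.one_apply, mul_inv_eq_iff_eq_mul]
  exact h

/-- The conjugation action of the Frattini quotient `G ⧸ Φ(G)` on `Z(Φ(G))`. -/
def frattiniQuotientAction (G : Type u) [Group G] :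
    G ⧸ frattini G →* MulAut (Subgroup.center (frattini G)) :=
  QuotientGroup.lift (frattini G) (conjCenterFrattini G) (conjCenterFrattini_of_mem G)

/-- The module given by an action of a group `Q` by automorphisms on an abelian group `A`, written
additively. The coefficient ring is `ℤ`, lifted to the universe of `Q`. -/
def repOfAction {Q A : Type u} [Group Q] [CommGroup A] (φ : Q →* MulAut A) :
    Rep.{u} (ULift.{u} ℤ) Q :=
  Rep.of (X := Additive A)
    { toFun := fun q =>
        { toFun := fun a => Additive.ofMul (φ q a.toMul)
          map_add' := fun a b => by simp
          map_smul' := fun n a => by simp [ULift.smul_def] }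
      map_one' := by ext; simp
      map_mul' := fun q r => by ext; simp }

open scoped IsMulCommutative in
/-- The Tate cohomology group `Ĥ⁰(G ⧸ Φ(G); Z(Φ(G)))` for the conjugation action. -/
noncomputable def frattiniTateH0 (G : Type u) [Group G] [Finite G] : ModuleCat.{u} (ULift.{u} ℤ) :=
  letI : Fintype (G ⧸ frattini G) := Fintype.ofFinite _
  tateCohomology (repOfAction (A := Subgroup.center (frattini G)) (frattiniQuotientAction G)) 0

/-- A finite nonabelian `p`-group `G` is an S-group if `Ĥ⁰(G ⧸ Φ(G); Z(Φ(G))) ≠ 0`. -/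
structure IsSGroup (p : ℕ) (G : Type u) [Group G] [Finite G] : Prop where
  isPGroup : IsPGroup p G
  nonabelian : ∃ a b : G, a * b ≠ b * a
  nontrivial_tate : Nontrivial (frattiniTateH0 G)

/-- A group of order `p ^ n` with `n ≥ 2` has maximal nilpotency class if its class is `n - 1`. -/
def HasMaximalClass (p : ℕ) (G : Type u) [Group G] : Prop :=
  ∃ n : ℕ, 2 ≤ n ∧ Nat.card G = p ^ n ∧ Group.IsNilpotent G ∧ Group.nilpotencyClass G = n - 1

/-!
For a finite group `Q` and a `Q`-module `M`, `Ĥ⁰(Q, M)` is the quotient of `M^Q` by the image of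
the norm `∑ q, q`. Here `Q = G ⧸ Φ(G)` and `M = Z(Φ(G))`. Since `M` is a nontrivial normal
subgroup of the `p`-group `G`, it contains nontrivial central elements, so `M^Q ≠ 0`. It therefore
suffices that the norm is zero.

Let `|G| = p ^ n` with class `n - 1`. Then `Φ(G)` has order `p ^ (n - 2)` and the normal subgroups
of `G` inside `Φ(G)` are the `Φ(G) ⊓ Z_k`, where `Z_k` is the upper central series
(`card_frattini_of_maximal_class`, `normal_le_or_le_of_le_frattini`). Both facts come from counting:
a normal subgroup `N` grows by a factor of at least `p` from `N ⊓ Z_j` to `N ⊓ Z_{j+1}` as long as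
`N` is not contained in `Z_j`, so a normal subgroup of order `p ^ k` lies in `Z_k`.

The group `Q` is noncyclic of order `p ^ 2`, hence a product of subgroups `H` and `K` of order `p`.
Because `Q` is abelian, `M^H` and `M^K` are normal in `G`, and so one contains the other, say
`M^K ⊆ M^H`. The norm of `K` then takes values in `M^K = M^Q`, and on `M^Q` the norm of `H` is
multiplication by `p`. As `M^Q` lies in `Φ(G) ⊓ Z_1`, of order at most `p`, the composite of the
two norms, which is the norm of `Q`, vanishes (`Representation.norm_eq_zero_of_isComplement'`).
-/

/-! ### Maximal subgroups and the Frattini subgroup of a finite nilpotent group -/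

/-- The centre of `G ⧸ M` is nontrivial by nilpotency, so its preimage is all of `G` by the
maximality of `M`. -/
theorem isMulCommutative_quotient_of_isCoatom {G : Type*} [Group G] [Group.IsNilpotent G]
    {M : Subgroup G} [M.Normal] (hM : IsCoatom M) : IsMulCommutative (G ⧸ M) := by
  have hnt : Nontrivial (G ⧸ M) := QuotientGroup.nontrivial_iff.mpr hM.1
  have hle : M ≤ (Subgroup.center (G ⧸ M)).comap (QuotientGroup.mk' M) := fun x hx => by
    have : QuotientGroup.mk' M x = 1 := (QuotientGroup.eq_one_iff x).mpr hx
    rw [Subgroup.mem_comap, this]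
    exact one_mem _
  rcases hM.le_iff.mp hle with h | h
  · refine ⟨⟨fun a b => ?_⟩⟩
    obtain ⟨a, rfl⟩ := QuotientGroup.mk'_surjective M a
    have ha : a ∈ (Subgroup.center (G ⧸ M)).comap (QuotientGroup.mk' M) := h ▸ Subgroup.mem_top a
    exact (Subgroup.mem_center_iff.mp (Subgroup.mem_comap.mp ha) b).symm
  · refine absurd ((Subgroup.eq_bot_iff_forall _).mpr fun x hx => ?_)
      (Group.IsNilpotent.center_ne_bot (G := G ⧸ M))
    obtain ⟨x, rfl⟩ := QuotientGroup.mk'_surjective M x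
    have : x ∈ M := h ▸ Subgroup.mem_comap.mpr hx
    exact (QuotientGroup.eq_one_iff x).mpr this

theorem commutator_le_frattini (G : Type*) [Group G] [Finite G] [Group.IsNilpotent G] :
    commutator G ≤ frattini G := by
  have hn := (Group.isNilpotent_of_finite_tfae (G := G)).out 0 2 |>.mp ‹_›
  rw [frattini, Order.radical]
  refine le_iInf₂ fun M hM => ?_
  have := hn M hM
  exact Subgroup.Normal.quotient_commutative_iff_commutator_le.mp
    (isMulCommutative_quotient_of_isCoatom hM)

/-- A generator of `G ⧸ Φ(G)` lifts to a generator of `G`, because elements of `Φ(G)` may be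
dropped from any generating set. -/
theorem isCyclic_of_isCyclic_quotient_frattini {G : Type*} [Group G] [Finite G]
    (h : IsCyclic (G ⧸ frattini G)) : IsCyclic G := by
  obtain ⟨q, hq⟩ := h.exists_generator
  obtain ⟨g, rfl⟩ := QuotientGroup.mk_surjective q
  refine ⟨g, fun x => ?_⟩
  change x ∈ Subgroup.zpowers g
  suffices Subgroup.zpowers g ⊔ frattini G = ⊤ by
    rw [frattini_nongenerating this]; exact Subgroup.mem_top x
  refine eq_top_iff.mpr fun y _ => ?_
  obtain ⟨k, hk⟩ := hq (y : G ⧸ frattini G)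
  have hk' : ((g ^ k : G) : G ⧸ frattini G) = y := hk
  have := Subgroup.mul_mem_sup (Subgroup.zpow_mem_zpowers g k) (QuotientGroup.eq.mp hk')
  simpa using this

/-! ### Normal subgroups and the upper central series -/

/-- In a nilpotent group `G`, a normal subgroup not contained in the `j`-th centre `Z_j` contains
an element of `Z_{j+1}` outside `Z_j`: the first `Z_i` meeting `N` outside `Z_j` does so in an
element whose commutators lie in `N ⊓ Z_{i-1} ≤ Z_j`. -/
theorem inf_upperCentralSeries_lt_succ {G : Type*} [Group G] [Group.IsNilpotent G]
    {N : Subgroup G} [N.Normal] {j : ℕ} (h : ¬ N ≤ Subgroup.upperCentralSeries G j) :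
    N ⊓ Subgroup.upperCentralSeries G j < N ⊓ Subgroup.upperCentralSeries G (j + 1) := by
  refine lt_of_le_not_ge (inf_le_inf_left N
    (Subgroup.upperCentralSeries_mono G j.le_succ)) fun hle => h ?_
  have key (i : ℕ) : N ⊓ Subgroup.upperCentralSeries G i ≤ Subgroup.upperCentralSeries G j := by
    induction i with
    | zero => simp
    | succ i ih =>
      rintro x ⟨hxN, hxi⟩
      refine (hle ⟨hxN, Subgroup.mem_upperCentralSeries_succ_iff.mpr fun y => ih ⟨?_, ?_⟩⟩).2
      · rw [commutatorElement_def, mul_assoc, mul_assoc, ← mul_assoc y]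
        exact N.mul_mem hxN (Subgroup.Normal.conj_mem ‹_› _ (N.inv_mem hxN) y)
      · exact Subgroup.mem_upperCentralSeries_succ_iff.mp hxi y
  obtain ⟨c, hc⟩ := Group.IsNilpotent.nilpotent G
  simpa [hc] using key c

theorem IsPGroup.card_mul_prime_le_of_lt {p : ℕ} [Fact p.Prime] {G : Type*} [Group G] [Finite G]
    (hG : IsPGroup p G) {H K : Subgroup G} (h : H < K) : Nat.card H * p ≤ Nat.card K := by
  obtain ⟨a, ha⟩ := (hG.to_subgroup H).exists_card_eq
  obtain ⟨b, hb⟩ := (hG.to_subgroup K).exists_card_eq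
  have hlt : Nat.card H < Nat.card K := lt_of_not_ge fun hge =>
    h.ne (Subgroup.eq_of_le_of_card_ge h.le hge)
  have hp : 1 < p := (Fact.out : p.Prime).one_lt
  rw [ha, hb] at hlt ⊢
  rw [← pow_succ]
  exact Nat.pow_le_pow_right hp.le ((Nat.pow_lt_pow_iff_right hp).mp hlt)

theorem IsPGroup.card_inf_upperCentralSeries_mul_pow_le {p : ℕ} [Fact p.Prime] {G : Type*}
    [Group G] [Finite G] (hG : IsPGroup p G) {N : Subgroup G} [N.Normal] {i d : ℕ}
    (h : ∀ e < d, ¬ N ≤ Subgroup.upperCentralSeries G (i + e)) :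
    Nat.card (N ⊓ Subgroup.upperCentralSeries G i : Subgroup G) * p ^ d ≤
      Nat.card (N ⊓ Subgroup.upperCentralSeries G (i + d) : Subgroup G) := by
  have := hG.isNilpotent
  induction d with
  | zero => simp
  | succ d ih =>
    calc _ = Nat.card (N ⊓ Subgroup.upperCentralSeries G i : Subgroup G) * p ^ d * p := by ring
      _ ≤ Nat.card (N ⊓ Subgroup.upperCentralSeries G (i + d) : Subgroup G) * p :=
        Nat.mul_le_mul_right _ (ih fun e he => h e (by omega))
      _ ≤ _ := hG.card_mul_prime_le_of_lt (inf_upperCentralSeries_lt_succ (h d d.lt_succ_self))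

/-- A normal subgroup of order `p ^ k` of a finite `p`-group lies in the `k`-th centre. -/
theorem IsPGroup.le_upperCentralSeries_of_card_eq {p : ℕ} [Fact p.Prime] {G : Type*}
    [Group G] [Finite G] (hG : IsPGroup p G) {N : Subgroup G} [N.Normal] {k : ℕ}
    (hN : Nat.card N = p ^ k) : N ≤ Subgroup.upperCentralSeries G k := by
  by_contra hnot
  have hlow := hG.card_inf_upperCentralSeries_mul_pow_le (N := N) (i := 0) (d := k)
    fun e he hle => hnot (hle.trans (Subgroup.upperCentralSeries_mono G (by omega)))
  have heq : N ⊓ Subgroup.upperCentralSeries G k = N :=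
    Subgroup.eq_of_le_of_card_ge inf_le_left (by simpa [hN] using hlow)
  exact hnot (inf_eq_left.mp heq)

/-! ### The Frattini subgroup of a group of maximal class -/

section

variable {p : ℕ} [Fact p.Prime] {G : Type*} [Group G] [Finite G] {n : ℕ}

/-- The order of `Φ(G)` is bounded above because `G ⧸ Φ(G)` is not cyclic, and below because
`G ⧸ Φ(G)` is abelian while `Φ(G)` lies in the centre of the index given by its order. -/
theorem card_frattini_of_maximal_class (hG : IsPGroup p G) (hnc : ¬ IsCyclic G)
    (hcard : Nat.card G = p ^ n) (hclass : Group.nilpotencyClass G = n - 1) :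
    ∃ m, n = m + 2 ∧ Nat.card (frattini G) = p ^ m := by
  have := hG.isNilpotent
  have hp1 : 1 < p := (Fact.out : p.Prime).one_lt
  obtain ⟨k, hk⟩ := (hG.to_subgroup (frattini G)).exists_card_eq
  obtain ⟨l, hl⟩ := (hG.to_quotient (frattini G)).exists_card_eq
  have hkl : n = l + k := by
    have h := Subgroup.card_eq_card_quotient_mul_card_subgroup (frattini G)
    rw [hcard, hk, hl, ← pow_add] at h
    exact Nat.pow_right_injective hp1 h
  have hl2 : 2 ≤ l := by
    by_contra hlt
    refine hnc (isCyclic_of_isCyclic_quotient_frattini ?_)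
    interval_cases l
    · have := (Nat.card_eq_one_iff_unique.mp (hl.trans (pow_zero p))).1
      infer_instance
    · exact isCyclic_of_prime_card (hl.trans (pow_one p))
  have htop : Subgroup.upperCentralSeries G (k + 1) = ⊤ := eq_top_iff.mpr fun x _ y =>
    hG.le_upperCentralSeries_of_card_eq hk
      (commutator_le_frattini G (Subgroup.commutator_mem_commutator (Subgroup.mem_top x)
        (Subgroup.mem_top y)))
  have := Subgroup.upperCentralSeries_eq_top_iff_nilpotencyClass_le.mp htop
  exact ⟨k, by omega, hk⟩

/-- From `Φ(G) ⊓ Z_j` upwards there are at least `m - j` strict steps before `Φ(G)` is exhausted,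
because `Φ(G) ≤ Z_i` forces `Z_{i+1} = G` and hence `i ≥ m`. -/
theorem card_frattini_inf_upperCentralSeries_le {m : ℕ} (hG : IsPGroup p G)
    (hclass : Group.nilpotencyClass G = m + 1) (hΦ : Nat.card (frattini G) = p ^ m)
    {j : ℕ} (hj : j ≤ m) :
    Nat.card (frattini G ⊓ Subgroup.upperCentralSeries G j : Subgroup G) ≤ p ^ j := by
  have := hG.isNilpotent
  obtain ⟨d, rfl⟩ := Nat.exists_eq_add_of_le hj
  have hp0 : 0 < p := (Fact.out : p.Prime).pos
  have hnot (e : ℕ) (he : e < d) : ¬ frattini G ≤ Subgroup.upperCentralSeries G (j + e) := by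
    intro hle
    have htop : Subgroup.upperCentralSeries G (j + e + 1) = ⊤ := eq_top_iff.mpr fun x _ y =>
      hle (commutator_le_frattini G (Subgroup.commutator_mem_commutator (Subgroup.mem_top x)
        (Subgroup.mem_top y)))
    have := Subgroup.upperCentralSeries_eq_top_iff_nilpotencyClass_le.mp htop
    omega
  have h := (hG.card_inf_upperCentralSeries_mul_pow_le hnot).trans
    (Subgroup.card_le_of_le inf_le_left)
  rw [hΦ, pow_add] at h
  exact Nat.le_of_mul_le_mul_right h (pow_pos hp0 d)

/-- In a `p`-group of maximal class the normal subgroups contained in `Φ(G)` form a chain: the one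
of order `p ^ k` is `Φ(G) ⊓ Z_k`. -/
theorem normal_le_or_le_of_le_frattini {m : ℕ} (hG : IsPGroup p G)
    (hclass : Group.nilpotencyClass G = m + 1) (hΦ : Nat.card (frattini G) = p ^ m)
    {N₁ N₂ : Subgroup G} [N₁.Normal] [N₂.Normal] (h₁ : N₁ ≤ frattini G) (h₂ : N₂ ≤ frattini G) :
    N₁ ≤ N₂ ∨ N₂ ≤ N₁ := by
  have hp1 : 1 < p := (Fact.out : p.Prime).one_lt
  have main (N : Subgroup G) [N.Normal] (hN : N ≤ frattini G) :
      ∃ k, N = frattini G ⊓ Subgroup.upperCentralSeries G k := by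
    obtain ⟨k, hk⟩ := (hG.to_subgroup N).exists_card_eq
    have hkm : k ≤ m := by
      have := Subgroup.card_le_of_le hN
      rw [hk, hΦ] at this
      exact (Nat.pow_le_pow_iff_right hp1).mp this
    refine ⟨k, Subgroup.eq_of_le_of_card_ge
      (le_inf hN (hG.le_upperCentralSeries_of_card_eq hk)) ?_⟩
    rw [hk]
    exact card_frattini_inf_upperCentralSeries_le hG hclass hΦ hkm
  obtain ⟨k₁, hk₁⟩ := main N₁ h₁
  obtain ⟨k₂, hk₂⟩ := main N₂ h₂
  rw [hk₁, hk₂]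
  exact (le_total k₁ k₂).imp
    (fun h => inf_le_inf_left _ (Subgroup.upperCentralSeries_mono G h))
    (fun h => inf_le_inf_left _ (Subgroup.upperCentralSeries_mono G h))

/-- The case `j = 1` of the bound on `Φ(G) ⊓ Z_j`: this intersection has order dividing `p`. -/
theorem pow_prime_eq_one_of_mem_frattini_of_mem_center {m : ℕ} (hG : IsPGroup p G)
    (hclass : Group.nilpotencyClass G = m + 1) (hΦ : Nat.card (frattini G) = p ^ m)
    {x : G} (hx : x ∈ frattini G) (hxc : x ∈ Subgroup.center G) : x ^ p = 1 := by
  have hp1 : 1 < p := (Fact.out : p.Prime).one_lt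
  rcases Nat.eq_zero_or_pos m with rfl | hm
  · rw [pow_zero] at hΦ
    rw [Subgroup.eq_bot_of_card_eq _ hΦ, Subgroup.mem_bot] at hx
    rw [hx, one_pow]
  · have hle := card_frattini_inf_upperCentralSeries_le hG hclass hΦ (j := 1) hm
    rw [Subgroup.upperCentralSeries_one, pow_one] at hle
    set C : Subgroup G := frattini G ⊓ Subgroup.center G
    obtain ⟨c, hc⟩ := (hG.to_subgroup C).exists_card_eq
    have hc1 : c ≤ 1 := by
      rw [hc] at hle
      exact (Nat.pow_le_pow_iff_right hp1).mp (by simpa using hle)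
    have hdvd : Nat.card C ∣ p := by
      rw [hc]; simpa using pow_dvd_pow p hc1
    exact orderOf_dvd_iff_pow_eq_one.mp ((Subgroup.orderOf_dvd_natCard C ⟨hx, hxc⟩).trans hdvd)

end

/-! ### Groups of order `p ^ 2` -/

theorem exists_isComplement'_of_card_eq_prime_sq {p : ℕ} [hp : Fact p.Prime] {Q : Type*} [Group Q]
    (hQ : Nat.card Q = p ^ 2) (hnc : ¬ IsCyclic Q) :
    ∃ H K : Subgroup Q, H.IsComplement' K ∧ Nat.card H = p ∧ Nat.card K = p := by
  have hp1 := hp.out.one_lt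
  have hfin : Finite Q := Nat.finite_of_card_ne_zero (by rw [hQ]; positivity)
  have hz {g : Q} (hg : g ≠ 1) : Nat.card (Subgroup.zpowers g) = p := by
    rw [Nat.card_zpowers]
    obtain ⟨k, hk, hgk⟩ := (Nat.dvd_prime_pow hp.out).mp (hQ ▸ orderOf_dvd_natCard g)
    interval_cases k
    · exact absurd (orderOf_eq_one_iff.mp (by simpa using hgk)) hg
    · simpa using hgk
    · exact absurd (isCyclic_of_orderOf_eq_card g (by rw [hgk, hQ])) hnc
  have hnt : Nontrivial Q := Finite.one_lt_card_iff_nontrivial.mp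
    (by rw [hQ]; exact Nat.one_lt_pow two_ne_zero hp1)
  obtain ⟨s, hs⟩ := exists_ne (1 : Q)
  obtain ⟨t, ht⟩ : ∃ t, t ∉ Subgroup.zpowers s := by
    by_contra! h
    exact hnc ⟨s, h⟩
  have ht1 : t ≠ 1 := fun h => ht (h ▸ one_mem _)
  refine ⟨Subgroup.zpowers s, Subgroup.zpowers t,
    Subgroup.isComplement'_of_card_mul_and_disjoint ?_ ?_, hz hs, hz ht1⟩
  · rw [hz hs, hz ht1, hQ, sq]
  · rw [disjoint_iff, Subgroup.eq_bot_iff_forall]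
    rintro x ⟨hxs, hxt⟩
    by_contra hx
    have e₁ := Subgroup.eq_of_le_of_card_ge (Subgroup.zpowers_le_of_mem hxs)
      (by rw [hz hs, hz hx])
    have e₂ := Subgroup.eq_of_le_of_card_ge (Subgroup.zpowers_le_of_mem hxt)
      (by rw [hz ht1, hz hx])
    exact ht (e₁ ▸ e₂ ▸ Subgroup.mem_zpowers t)

/-! ### The norm and Tate cohomology in degree zero -/

open CategoryTheory in
/-- If the norm vanishes on `M`, then `Ĥ⁰(Q, M)` is all of `M^Q`. -/
theorem nontrivial_tateCohomology_zero_of_norm_eq_zero {k Q : Type u} [CommRing k] [Group Q]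
    [Fintype Q] (M : Rep.{u} k Q) (hnorm : M.ρ.norm = 0) {v : M} (hv : v ≠ 0)
    (hfix : ∀ q, M.ρ q v = v) : Nontrivial (tateCohomology M 0) := by
  rw [← not_subsingleton_iff_nontrivial]
  intro hsub
  have hzero : Limits.IsZero ((tateComplex M).homology 0) := 
    @ModuleCat.isZero_of_subsingleton _ _ _ hsub
  have hex := (HomologicalComplex.exactAt_iff' _ (-1) 0 1 (by simp) (by simp)).mp
    ((HomologicalComplex.exactAt_iff_isZero_homology _ _).mpr hzero)
  rw [ShortComplex.moduleCat_exact_iff] at hex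
  obtain ⟨x, hx⟩ := hex ((groupCohomology.cochainsIso₀ M).inv v) (by
    have h := congrArg (fun f => f.hom v) (groupCohomology.eq_d₀₁_comp_inv M)
    have h0 : (groupCohomology.d₀₁ M).hom v = 0 := by
      ext q
      rw [groupCohomology.d₀₁_hom_apply, hfix, sub_self, Pi.zero_apply]
    refine Eq.trans h ?_
    change (groupCohomology.cochainsIso₁ M).inv.hom ((groupCohomology.d₀₁ M).hom v) = 0
    rw [h0, map_zero])
  have htn : M.tateNorm = 0 := by
    rw [Rep.tateNorm_eq, hnorm]
    ext
    simp
    rfl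
  have hx0 : (groupCohomology.cochainsIso₀ M).inv v = 0 := by
    rw [← hx]
    change M.tateNorm.hom x = 0
    rw [htn]; rfl
  exact hv ((ModuleCat.mono_iff_injective (groupCohomology.cochainsIso₀ M).inv).mp inferInstance
    (hx0.trans (map_zero _).symm))

/-- If `Q` is the product of subgroups `H` and `K` and `M^K ⊆ M^H`, then the partial norm of `K`
takes values in `M^Q`, on which the partial norm of `H` is multiplication by `|H|`. -/
theorem Representation.norm_eq_zero_of_isComplement' {k Q V : Type*} [CommRing k] [Group Q]
    [Fintype Q] [AddCommGroup V] [Module k V] (ρ : Representation k Q V) {H K : Subgroup Q}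
    (hHK : H.IsComplement' K)
    (hle : ∀ v, (∀ x ∈ K, ρ x v = v) → ∀ x ∈ H, ρ x v = v)
    (htors : ∀ v, (∀ q, ρ q v = v) → Nat.card H • v = 0) : ρ.norm = 0 := by
  classical
  ext v
  set w : V := ∑ y : K, ρ y v with hw
  have hK : ∀ x ∈ K, ρ x w = w := fun x hx => by
    rw [hw, map_sum]
    simp_rw [← Module.End.mul_apply, ← map_mul]
    exact Fintype.sum_equiv (Equiv.mulLeft (⟨x, hx⟩ : K)) _ _ fun y => rfl
  have hH := hle w hK
  have hQ : ∀ q, ρ q w = w := fun q => by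
    obtain ⟨⟨x, y⟩, rfl⟩ := hHK.2 q
    change ρ (x * y : Q) w = w
    rw [map_mul, Module.End.mul_apply, hK y y.2, hH x x.2]
  calc ρ.norm v = ∑ q : Q, ρ q v := by simp [Representation.norm]
    _ = ∑ xy : H × K, ρ (xy.1 * xy.2 : Q) v :=
      (Fintype.sum_bijective (fun xy : H × K => (xy.1 * xy.2 : Q)) hHK _ _ fun _ => rfl).symm
    _ = ∑ x : H, ρ x w := by
      rw [Fintype.sum_prod_type]
      simp [hw, map_sum]
    _ = Nat.card H • w := by
      rw [Finset.sum_congr rfl fun (x : H) _ => hH x x.2]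
      simp
    _ = 0 := htors w hQ

/-! ### The action of the Frattini quotient on `Z(Φ(G))` -/

section

variable {G : Type u} [Group G]

/-- `Z(Φ(G))` as a homomorphism into `G`. -/
def centerFrattiniToGroup (G : Type u) [Group G] : Subgroup.center (frattini G) →* G :=
  (frattini G).subtype.comp (Subgroup.center (frattini G)).subtype

theorem centerFrattiniToGroup_injective :
    Function.Injective (centerFrattiniToGroup G) :=
  Subtype.val_injective.comp Subtype.val_injective

theorem centerFrattiniToGroup_frattiniQuotientAction (g : G)
    (a : Subgroup.center (frattini G)) :
    centerFrattiniToGroup G (frattiniQuotientAction G g a) =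
      g * centerFrattiniToGroup G a * g⁻¹ := rfl

/-- The image in `G` of the fixed points `Z(Φ(G))^K` of a subgroup `K` of the Frattini quotient. -/
def fixedCenterFrattini (K : Subgroup (G ⧸ frattini G)) : Subgroup G :=
  Subgroup.map (centerFrattiniToGroup G)
    { carrier := {a | ∀ q ∈ K, frattiniQuotientAction G q a = a}
      one_mem' := fun q _ => map_one _
      mul_mem' := fun ha hb q hq => by rw [map_mul, ha q hq, hb q hq]
      inv_mem' := fun ha q hq => by rw [map_inv, ha q hq] }

theorem fixedCenterFrattini_le (K : Subgroup (G ⧸ frattini G)) :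
    fixedCenterFrattini K ≤ frattini G := by
  rintro _ ⟨a, -, rfl⟩
  exact (a : frattini G).2

theorem centerFrattiniToGroup_mem_fixedCenterFrattini {K : Subgroup (G ⧸ frattini G)}
    {a : Subgroup.center (frattini G)} :
    centerFrattiniToGroup G a ∈ fixedCenterFrattini K ↔
      ∀ q ∈ K, frattiniQuotientAction G q a = a :=
  Subgroup.mem_map_iff_mem centerFrattiniToGroup_injective

/-- Since the Frattini quotient is abelian, the fixed points of `K` are stable under it. -/
theorem fixedCenterFrattini_normal (hcomm : ∀ q r : G ⧸ frattini G, q * r = r * q)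
    (K : Subgroup (G ⧸ frattini G)) : (fixedCenterFrattini K).Normal := by
  refine ⟨?_⟩
  rintro _ ⟨a, ha, rfl⟩ g
  rw [← centerFrattiniToGroup_frattiniQuotientAction,
    centerFrattiniToGroup_mem_fixedCenterFrattini]
  intro q hq
  rw [← MulAut.mul_apply, ← map_mul, hcomm, map_mul, MulAut.mul_apply, ha q hq]

theorem centerFrattiniToGroup_mem_center {a : Subgroup.center (frattini G)} :
    centerFrattiniToGroup G a ∈ Subgroup.center G ↔
      ∀ q, frattiniQuotientAction G q a = a := by
  rw [Subgroup.mem_center_iff, QuotientGroup.mk_surjective.forall]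
  refine forall_congr' fun g => ?_
  rw [← centerFrattiniToGroup_injective.eq_iff, centerFrattiniToGroup_frattiniQuotientAction,
    mul_inv_eq_iff_eq_mul]

/-- A nontrivial normal subgroup of a nilpotent group, here `Z(Φ(G))`, meets the centre. -/
theorem exists_ne_one_forall_frattiniQuotientAction_eq [Group.IsNilpotent G]
    (hnt : Nontrivial (Subgroup.center (frattini G))) :
    ∃ a : Subgroup.center (frattini G), a ≠ 1 ∧ ∀ q, frattiniQuotientAction G q a = a := by
  have hnormal : (centerFrattiniToGroup G).range.Normal := by
    refine ⟨?_⟩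
    rintro _ ⟨a, rfl⟩ g
    exact ⟨frattiniQuotientAction G g a, centerFrattiniToGroup_frattiniQuotientAction g a⟩
  obtain ⟨b, hb⟩ := exists_ne (1 : Subgroup.center (frattini G))
  have hnot : ¬ (centerFrattiniToGroup G).range ≤ Subgroup.upperCentralSeries G 0 := fun hle =>
    hb ((injective_iff_map_eq_one _).mp centerFrattiniToGroup_injective b (hle ⟨b, rfl⟩))
  obtain ⟨x, ⟨⟨a, rfl⟩, hx⟩, hx0⟩ := SetLike.exists_of_lt (inf_upperCentralSeries_lt_succ hnot)
  refine ⟨a, fun ha => hx0 (by rw [ha, map_one]; exact one_mem _), ?_⟩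
  rw [zero_add, Subgroup.upperCentralSeries_one] at hx
  exact centerFrattiniToGroup_mem_center.mp hx

end

/-! ### Groups of maximal class are S-groups -/

open scoped IsMulCommutative in
/-- With `G ⧸ Φ(G)` the product of two subgroups `H` and `K` of order `p`, the points of `Z(Φ(G))`
fixed by `H` and those fixed by `K` are comparable, and the points fixed by both have order
dividing `p`; hence the norm vanishes. -/
theorem norm_eq_zero_of_maximal_class {p : ℕ} [Fact p.Prime] {G : Type u} [Group G]
    [Finite G] [Fintype (G ⧸ frattini G)] {m : ℕ} (hG : IsPGroup p G) (hnc : ¬ IsCyclic G)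
    (hcard : Nat.card G = p ^ (m + 2)) (hclass : Group.nilpotencyClass G = m + 1)
    (hΦ : Nat.card (frattini G) = p ^ m) :
    (repOfAction (A := Subgroup.center (frattini G)) (frattiniQuotientAction G)).ρ.norm = 0 := by
  have hp0 : 0 < p := (Fact.out : p.Prime).pos
  have hQ : Nat.card (G ⧸ frattini G) = p ^ 2 := by
    have h := Subgroup.card_eq_card_quotient_mul_card_subgroup (frattini G)
    rw [hcard, hΦ, pow_add, mul_comm] at h
    exact (Nat.eq_of_mul_eq_mul_right (pow_pos hp0 m) h).symm
  have hcomm := (IsPGroup.isMulCommutative_of_card_eq_prime_sq hQ).is_comm.comm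
  obtain ⟨H, K, hHK, hH, hK⟩ := exists_isComplement'_of_card_eq_prime_sq hQ
    fun h => hnc (isCyclic_of_isCyclic_quotient_frattini h)
  have htors (v : Additive (Subgroup.center (frattini G)))
      (hv : ∀ q, frattiniQuotientAction G q v.toMul = v.toMul) : p • v = 0 := by
    refine Additive.toMul.injective (centerFrattiniToGroup_injective ?_)
    change centerFrattiniToGroup G (v.toMul ^ p) = centerFrattiniToGroup G 1
    rw [map_pow, map_one]
    exact pow_prime_eq_one_of_mem_frattini_of_mem_center hG hclass hΦ
      (v.toMul : frattini G).2 (centerFrattiniToGroup_mem_center.mpr hv)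
  have hfix {L₁ L₂ : Subgroup (G ⧸ frattini G)}
      (h : fixedCenterFrattini L₁ ≤ fixedCenterFrattini L₂)
      (a : Subgroup.center (frattini G)) (ha : ∀ q ∈ L₁, frattiniQuotientAction G q a = a) :
      ∀ q ∈ L₂, frattiniQuotientAction G q a = a :=
    centerFrattiniToGroup_mem_fixedCenterFrattini.mp
      (h (centerFrattiniToGroup_mem_fixedCenterFrattini.mpr ha))
  have := fixedCenterFrattini_normal hcomm H
  have := fixedCenterFrattini_normal hcomm K
  rcases normal_le_or_le_of_le_frattini hG hclass hΦ
    (fixedCenterFrattini_le K) (fixedCenterFrattini_le H) with h | h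
  · exact Representation.norm_eq_zero_of_isComplement' _ hHK
      (fun v hv => hfix h v.toMul hv) (fun v hv => hH ▸ htors v hv)
  · exact Representation.norm_eq_zero_of_isComplement' _ hHK.symm
      (fun v hv => hfix h v.toMul hv) (fun v hv => hK ▸ htors v hv)

theorem mainTheorem8 {p : ℕ} (hp : p.Prime) {G : Type u} [Group G] [Finite G]
    (hpG : IsPGroup p G) (hnonab : ∃ a b : G, a * b ≠ b * a) (hmax : HasMaximalClass p G) :
    IsSGroup p G := by
  have : Fact p.Prime := ⟨hp⟩
  obtain ⟨n, -, hcard, hnil, hclass⟩ := hmax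
  obtain ⟨x, y, hxy⟩ := hnonab
  have hnc : ¬ IsCyclic G := fun h => hxy (h.isMulCommutative.is_comm.comm x y)
  obtain ⟨m, rfl, hΦ⟩ := card_frattini_of_maximal_class hpG hnc hcard hclass
  have hclass' : Group.nilpotencyClass G = m + 1 := hclass
  have hnt : Nontrivial (frattini G) := by
    rw [Subgroup.nontrivial_iff_ne_bot]
    intro hbot
    have hmem := commutator_le_frattini G
      (Subgroup.commutator_mem_commutator (Subgroup.mem_top x) (Subgroup.mem_top y))
    rw [hbot, Subgroup.mem_bot, commutatorElement_eq_one_iff_mul_comm] at hmem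
    exact hxy hmem
  obtain ⟨a, ha, hfix⟩ := exists_ne_one_forall_frattiniQuotientAction_eq
    (hpG.to_subgroup (frattini G)).center_nontrivial
  refine ⟨hpG, ⟨x, y, hxy⟩, ?_⟩
  let _ : Fintype (G ⧸ frattini G) := Fintype.ofFinite _
  exact nontrivial_tateCohomology_zero_of_norm_eq_zero _
    (norm_eq_zero_of_maximal_class hpG hnc hcard hclass' hΦ)
    (v := Additive.ofMul a) ha hfix
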